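/- Let $\omega_1$ carry its order topology. For $S \subseteq \omega_1$ let $\mathrm{cl}(S)$ be the closure of $S$ in $\omega_1$, and let $\mathcal{K}(S)$ be the set of all compact subsets of the subspace $S$ (including $\emptyset$), ordered by inclusion. For directed posets $P$ and $Q$ write $P \ge_T Q$ if there is a map $\phi : P \to Q$ that takes cofinal subsets of $P$ to cofinal subsets of $Q$, and write $P =_T Q$ if $P \ge_T Q$ and $Q \ge_T P$. A subset of $\omega_1$ is stationary if it meets every closed unbounded subset of $\omega_1$, and co-stationary if its complement in $\omega_1$ is stationary. (1) Let $S, T \subseteq \omega_1$ be such that $\mathrm{cl}(S) \setminus S$ is unbounded in $\omega_1$, $S$ is stationary, and the symmetric difference $S \,\Delta\, T$ is non-stationary. Then $\mathcal{K}(S) \ge_T \mathcal{K}(T)$. (2) Consequently, if $S, T \subseteq \omega_1$ are both stationary and co-stationary and $S \,\Delta\, T$ is non-stationary, then $\mathcal{K}(S) =_T \mathcal{K}(T)$. -/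

import Mathlib

open scoped Ordinal

/-- The space of all countable ordinals, with the order and the (order) topology
inherited from the ordinals. -/
abbrev OmegaOne : Type 1 := Set.Iio (ω₁ : Ordinal.{0})

/-- `P ≥_T Q`: there is a map `φ : P → Q` (a Tukey quotient) that takes cofinal subsets of `P` to
cofinal subsets of `Q`. -/
def TukeyGE (P Q : Type*) [PartialOrder P] [PartialOrder Q] : Prop :=
  ∃ φ : P → Q, ∀ C : Set P, IsCofinal C → IsCofinal (φ '' C)

/-- `P =_T Q`: each of the two posets is a Tukey quotient of the other. -/
def TukeyEquiv (P Q : Type*) [PartialOrder P] [PartialOrder Q] : Prop :=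
  TukeyGE P Q ∧ TukeyGE Q P

/-- `𝒦(S)`: the compact subsets of the subspace `S` of `ω₁`, ordered by inclusion. -/
abbrev KK (S : Set OmegaOne) : Type 1 := TopologicalSpace.Compacts S

/-! Since `S` is stationary and the limits of `closure S \ S` form a club, the set `X` of points of
`S` that are such limits is unbounded. Intersecting the club of limits of `X` with a club missing
`symmDiff S T` gives a club `D` on which `S` and `T` agree; it cuts the space into blocks, each
ending at a point of `D`. A block ending at a limit of `D` is a single point, where `S` and `T`
agree. Any other block contains a final segment below its endpoint, hence a point of `X`: there the
compact subsets of `S` are Tukey above `ℕ → ℕ` (`exists_tukey_of_nat_fun`), while those of `T` in a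
countable block are below it (`exists_tukey_to_nat_fun`). The blockwise maps are glued by taking the
closure of a union. As they preserve emptiness and nonemptiness, new limit points lie in `D` and in
the given compact set, so it does not matter whether `S` or `T` is meant
(`closure_iUnion_clubBlock_subset`). -/

open Set Filter Topology

/-! ### Clubs, stationary sets and blocks. -/

section Order

variable {α : Type*} [LinearOrder α]

/-- The points of a linear order that are limits from below of points of `X`. -/
def leftLimits (X : Set α) : Set α :=
  {x | (∃ a, a < x) ∧ ∀ a < x, ∃ y ∈ X, a < y ∧ y < x}

theorem dirSupClosed_leftLimits (X : Set α) : DirSupClosed (leftLimits X) := by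
  intro t ht ht0 _ x hx
  obtain ⟨z, hz⟩ := ht0
  refine ⟨?_, fun a ha => ?_⟩
  · obtain ⟨a, ha⟩ := (ht hz).1
    exact ⟨a, ha.trans_le (hx.1 hz)⟩
  · obtain ⟨z, hz, haz, hzx⟩ := hx.exists_between ha
    obtain ⟨y, hy, hay, hyz⟩ := (ht hz).2 a haz
    exact ⟨y, hy, hay, hyz.trans_le hzx⟩

/-- The supremum of a strictly increasing sequence from `X` is a limit of `X`. -/
theorem isCofinal_leftLimits [WellFoundedLT α] [NoMaxOrder α]
    (hb : ∀ s : Set α, s.Countable → BddAbove s) {X : Set α} (hX : IsCofinal X) :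
    IsCofinal (leftLimits X) := by
  have hX' : ∀ a, ∃ y ∈ X, a < y := fun a => by
    obtain ⟨b, hab⟩ := exists_gt a
    obtain ⟨y, hy, hby⟩ := hX b
    exact ⟨y, hy, hab.trans_le hby⟩
  choose f hfX hf using hX'
  intro a
  let u : ℕ → α := fun n => f^[n] a
  have hu : ∀ n, u (n + 1) = f (u n) := fun n => Function.iterate_succ_apply' f n a
  have hlt : ∀ n, u n < u (n + 1) := fun n => (hu n).symm ▸ hf _
  obtain ⟨x, hx, hmin⟩ := WellFounded.has_min (wellFounded_lt (α := α)) _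
    (hb (range u) (countable_range u))
  have hux : ∀ n, u n < x := fun n => (hlt n).trans_le (hx (mem_range_self _))
  refine ⟨x, ⟨⟨_, hux 0⟩, fun b hbx => ?_⟩, (hux 0).le⟩
  have : b ∉ upperBounds (range u) := fun h => hmin b h hbx
  simp only [mem_upperBounds, forall_mem_range, not_forall, not_le] at this
  obtain ⟨n, hn⟩ := this
  exact ⟨u (n + 1), (hu n).symm ▸ hfX _, hn.trans (hlt n), hux _⟩

theorem isClub_leftLimits [WellFoundedLT α] [NoMaxOrder α]
    (hb : ∀ s : Set α, s.Countable → BddAbove s) {X : Set α} (hX : IsCofinal X) :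
    IsClub (leftLimits X) :=
  ⟨dirSupClosed_leftLimits X, isCofinal_leftLimits hb hX⟩

theorem IsClub.inter_Ici {C : Set α} (hC : IsClub C) (a : α) : IsClub (C ∩ Ici a) := by
  refine ⟨fun t ht ht0 hd x hx => ⟨hC.dirSupClosed (fun z hz => (ht hz).1) ht0 hd hx, ?_⟩,
    fun b => ?_⟩
  · obtain ⟨z, hz⟩ := ht0
    exact (ht hz).2.trans (hx.1 hz)
  · obtain ⟨y, hy, hby⟩ := hC.isCofinal (max a b)
    exact ⟨y, ⟨hy, (le_max_left _ _).trans hby⟩, (le_max_right _ _).trans hby⟩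

theorem IsStationary.isCofinal_inter {S C : Set α} (hS : IsStationary S) (hC : IsClub C) :
    IsCofinal (S ∩ C) := fun a => by
  obtain ⟨x, hxS, hxC, hax⟩ := hS (hC.inter_Ici a)
  exact ⟨x, ⟨hxS, hxC⟩, hax⟩

theorem IsStationary.isCofinal {S : Set α} (hS : IsStationary S) : IsCofinal S :=
  (hS.isCofinal_inter IsClub.univ).mono inter_subset_left

/-- The half-open interval of points for which `β` is the first member of `D` at or above them. -/
def clubBlock (D : Set α) (β : α) : Set α :=
  {x | x ≤ β ∧ ∀ d ∈ D, d < β → d < x}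

theorem exists_mem_clubBlock [WellFoundedLT α] {D : Set α} (hD : IsCofinal D) (x : α) :
    ∃ β ∈ D, x ∈ clubBlock D β := by
  obtain ⟨b, hb, hxb⟩ := hD x
  obtain ⟨β, ⟨hβ, hxβ⟩, hmin⟩ := WellFounded.has_min (wellFounded_lt (α := α)) {b | b ∈ D ∧ x ≤ b}
    ⟨b, hb, hxb⟩
  exact ⟨β, hβ, hxβ, fun d hd hdβ => lt_of_not_ge fun h => hmin d ⟨hd, h⟩ hdβ⟩

theorem clubBlock_unique {D : Set α} {β γ x : α} (hβ : β ∈ D) (hγ : γ ∈ D)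
    (hxβ : x ∈ clubBlock D β) (hxγ : x ∈ clubBlock D γ) : β = γ := by
  rcases lt_trichotomy β γ with h | h | h
  · exact absurd (hxγ.2 β hβ h) hxβ.1.not_gt
  · exact h
  · exact absurd (hxβ.2 γ hγ h) hxγ.1.not_gt

end Order

/-! ### Compact sets, local Tukey maps and their gluing. -/

section Topology

variable {α : Type*} [TopologicalSpace α]

/-- For a subset `T` with countable complement in a compact first countable space, the compact
subsets of `T` are Tukey below `ℕ → ℕ`. -/
theorem exists_tukey_to_nat_fun [T2Space α] [FirstCountableTopology α] {X T : Set α}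
    (hX : IsCompact X) (hXT : (X \ T).Countable) :
    ∃ g : Set α → ℕ → ℕ, ∀ f : ℕ → ℕ, ∃ M ⊆ X ∩ T, IsCompact M ∧
      ∀ L ⊆ X ∩ T, IsCompact L → g L ≤ f → L ⊆ M := by
  rcases isEmpty_or_nonempty α with h | h
  · exact ⟨fun _ => 0, fun f => ⟨∅, empty_subset _, isCompact_empty,
      fun L _ _ _ x => h.elim x⟩⟩
  obtain ⟨e, he⟩ := countable_iff_exists_subset_range.1 hXT
  choose U hU using fun y : α => (𝓝 y).exists_antitone_basis
  -- `g L n` records how close `L` comes to the missing point `e n`; indices with `e n ∈ T` are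
  -- irrelevant.
  have key : ∀ (L : Set α) (n : ℕ), ∃ k, L ⊆ X ∩ T → IsCompact L → e n ∉ T →
      Disjoint (U (e n) k) L := by
    intro L n
    by_cases h : L ⊆ X ∩ T ∧ IsCompact L ∧ e n ∉ T
    · obtain ⟨hL, hc, hn⟩ := h
      have : Lᶜ ∈ 𝓝 (e n) := hc.isClosed.isOpen_compl.mem_nhds fun h => hn (hL h).2
      obtain ⟨k, hk⟩ := (hU (e n)).mem_iff.1 this
      exact ⟨k, fun _ _ _ => disjoint_left.2 fun x hx => hk hx⟩
    · exact ⟨0, fun h1 h2 h3 => absurd ⟨h1, h2, h3⟩ h⟩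
  choose g hg using key
  refine ⟨g, fun f => ⟨X \ ⋃ n ∈ {n | e n ∉ T}, interior (U (e n) (f n)), ?_, ?_, ?_⟩⟩
  · rintro x ⟨hxX, hx⟩
    refine ⟨hxX, by_contra fun hxT => hx ?_⟩
    obtain ⟨n, rfl⟩ := he ⟨hxX, hxT⟩
    exact mem_biUnion (x := n) hxT (mem_interior_iff_mem_nhds.2 ((hU (e n)).mem _))
  · exact hX.diff (isOpen_biUnion fun _ _ => isOpen_interior)
  · intro L hL hc hgf x hx
    refine ⟨(hL hx).1, fun hx' => ?_⟩
    obtain ⟨n, hn, hxn⟩ := mem_iUnion₂.1 hx'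
    exact disjoint_left.1 (hg L n hL hc hn) ((hU (e n)).antitone (hgf n) (interior_subset hxn)) hx

/-- The compact subsets of `S ∩ B` are Tukey above those of `T ∩ B`, by a map that preserves
emptiness and nonemptiness. -/
def LocalTukey (S T B : Set α) : Prop :=
  ∃ A : Set α → Set α, A ∅ = ∅ ∧
    (∀ L ⊆ T ∩ B, IsCompact L → A L ⊆ S ∩ B ∧ IsCompact (A L) ∧ (L.Nonempty → (A L).Nonempty)) ∧
    ∀ K ⊆ S, IsCompact K → ∃ M ⊆ T ∩ B, IsCompact M ∧
      ∀ L ⊆ T ∩ B, IsCompact L → A L ⊆ K → L ⊆ M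

theorem localTukey_of_inter_eq {S T B : Set α} (hB : B.Finite) (h : S ∩ B = T ∩ B) :
    LocalTukey S T B := by
  refine ⟨id, rfl, fun L hL hc => ⟨h ▸ hL, hc, id⟩, fun K _ _ => ⟨T ∩ B, Subset.rfl,
    (hB.subset inter_subset_right).isCompact, fun L hL _ _ => hL⟩⟩

variable [LinearOrder α] [OrderTopology α]

/-- Near a point of `S` that is a limit of missing limits of `S`, the compact subsets of `S` are
Tukey above `ℕ → ℕ`. -/
theorem exists_tukey_of_nat_fun [FirstCountableTopology α] {S : Set α} {a x : α}
    (hax : a < x) (hxS : x ∈ S) (hx : x ∈ leftLimits (closure S \ S)) :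
    ∃ h : (ℕ → ℕ) → Set α, (∀ f, h f ⊆ S ∩ Ioc a x ∧ IsCompact (h f) ∧ (h f).Nonempty) ∧
      ∀ K ⊆ S, IsCompact K → ∃ b : ℕ → ℕ, ∀ f, h f ⊆ K → f ≤ b := by
  have hlub : IsLUB ((closure S \ S) ∩ Ioo a x) x := by
    refine ⟨fun y hy => hy.2.2.le, fun b hb => le_of_not_gt fun hbx => ?_⟩
    obtain ⟨y, hy, hby, hyx⟩ := hx.2 (max a b) (max_lt hax hbx)
    exact (hb ⟨hy, (le_max_left _ _).trans_lt hby, hyx⟩).not_gt ((le_max_right _ _).trans_lt hby)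
  obtain ⟨y₀, hy₀, h₀, h₀'⟩ := hx.2 a hax
  obtain ⟨u, hu, hux, hlim, hmem⟩ := hlub.exists_seq_strictMono_tendsto_of_notMem
    (fun h => lt_irrefl _ h.2.2) ⟨y₀, hy₀, h₀, h₀'⟩
  -- Each missing point `u (n + 1)` is approached by a sequence `s n` in `S`. Choosing the `f n`-th
  -- term for every `n` gives a sequence squeezed to `x`.
  have hs : ∀ n, ∃ s : ℕ → α, (∀ k, s k ∈ Ioo (u n) (u (n + 2)) ∩ S) ∧
      Tendsto s atTop (𝓝 (u (n + 1))) := fun n => by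
    refine mem_closure_iff_seq_limit.1 (isOpen_Ioo.inter_closure ⟨⟨hu ?_, hu ?_⟩, (hmem _).1.1⟩)
    all_goals omega
  choose s hs hslim using hs
  refine ⟨fun f => insert x (range fun n => s n (f n)), fun f => ⟨?_, ?_, insert_nonempty _ _⟩, ?_⟩
  · refine insert_subset ⟨hxS, hax, le_rfl⟩ (range_subset_iff.2 fun n => ⟨(hs n _).2, ?_, ?_⟩)
    · exact (hmem n).2.1.trans (hs n _).1.1
    · exact ((hs n _).1.2.trans (hux _)).le
  · refine Tendsto.isCompact_insert_range ?_
    exact tendsto_of_tendsto_of_tendsto_of_le_of_le hlim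
      (hlim.comp (tendsto_add_atTop_nat 2)) (fun n => (hs n _).1.1.le) (fun n => (hs n _).1.2.le)
  · intro K hKS hK
    -- `K` is closed and omits `u (n + 1)`, so it contains no late term of `s n`.
    have hev : ∀ n, ∃ b, ∀ k, s n k ∈ K → k ≤ b := fun n => by
      have hKc : Kᶜ ∈ 𝓝 (u (n + 1)) :=
        hK.isClosed.isOpen_compl.mem_nhds fun h => (hmem (n + 1)).1.2 (hKS h)
      obtain ⟨b, hb⟩ := eventually_atTop.1 ((hslim n).eventually hKc)
      exact ⟨b, fun k hk => le_of_not_gt fun hbk => hb k hbk.le hk⟩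
    choose b hb using hev
    exact ⟨b, fun f hf n => hb n _ (hf (mem_insert_of_mem _ (mem_range_self n)))⟩

theorem leftLimits_subset_closure (X : Set α) : leftLimits X ⊆ closure X := by
  intro x hx
  have hlub : IsLUB (X ∩ Iio x) x := by
    refine ⟨fun y hy => hy.2.le, fun b hb => le_of_not_gt fun hbx => ?_⟩
    obtain ⟨y, hy, hby, hyx⟩ := hx.2 b hbx
    exact (hb ⟨hy, hyx⟩).not_gt hby
  obtain ⟨a, ha⟩ := hx.1
  obtain ⟨y, hy, -, hyx⟩ := hx.2 a ha
  exact closure_mono inter_subset_left (hlub.mem_closure ⟨y, hy, hyx⟩)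

theorem Iic_mem_nhds_of_wellFoundedLT [WellFoundedLT α] [NoMaxOrder α] (x : α) :
    Iic x ∈ 𝓝 x := by
  obtain ⟨y, hy, hmin⟩ := WellFounded.has_min (wellFounded_lt (α := α)) (Ioi x) (exists_gt x)
  exact mem_of_superset (Iio_mem_nhds hy) fun z hz => le_of_not_gt fun h => hmin z h hz

theorem firstCountableTopology_of_countable_Iio [WellFoundedLT α] [NoMaxOrder α]
    (hc : ∀ x : α, (Iio x).Countable) : FirstCountableTopology α := by
  refine ⟨fun x => ?_⟩
  have : 𝓝 x = (⨅ b ∈ Iio x, 𝓟 (Ioi b)) ⊓ 𝓟 (Iic x) := by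
    refine le_antisymm (le_inf ?_ (le_principal_iff.2 (Iic_mem_nhds_of_wellFoundedLT x))) ?_
    · rw [nhds_eq_order]
      exact inf_le_left
    · rw [nhds_eq_order]
      exact inf_le_inf le_rfl (le_iInf₂ fun b hb => principal_mono.2 fun z hz => lt_of_le_of_lt hz hb)
  rw [this]
  have := (hc x).to_subtype
  rw [iInf_subtype']
  infer_instance

/-- Compact pieces in the blocks of a club `D` can only accumulate at points of `D` where the
blocks they occupy accumulate. -/
theorem closure_iUnion_clubBlock_subset [WellFoundedLT α] [NoMaxOrder α] {D : Set α}
    (hD : IsClub D) {C : α → Set α} (hCB : ∀ β ∈ D, C β ⊆ clubBlock D β)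
    (hC : ∀ β ∈ D, IsClosed (C β)) {K : Set α} (hK : IsClosed K)
    (hCK : ∀ β ∈ D, (C β).Nonempty → (K ∩ clubBlock D β).Nonempty) :
    closure (⋃ β ∈ D, C β) ⊆ (⋃ β ∈ D, C β) ∪ K ∩ D := by
  intro x hx
  by_cases hlim : x ∈ leftLimits D
  · have hxD : x ∈ D := by
      refine hD.isLUB_mem (t := D ∩ Iio x) inter_subset_left ?_ ?_
      · obtain ⟨a, ha⟩ := hlim.1
        obtain ⟨y, hy, -, hyx⟩ := hlim.2 a ha
        exact ⟨y, hy, hyx⟩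
      · refine ⟨fun y hy => hy.2.le, fun b hb => le_of_not_gt fun hbx => ?_⟩
        obtain ⟨y, hy, hby, hyx⟩ := hlim.2 b hbx
        exact (hb ⟨hy, hyx⟩).not_gt hby
    by_cases hxU : x ∈ ⋃ β ∈ D, C β
    · exact Or.inl hxU
    refine Or.inr ⟨?_, hxD⟩
    rw [← hK.closure_eq]
    -- Between any `a < x` and `x` there is a whole occupied block above some `d > a` in `D`, and
    -- `K` meets it.
    refine leftLimits_subset_closure K ⟨hlim.1, fun a ha => ?_⟩
    obtain ⟨d, hd, had, hdx⟩ := hlim.2 a ha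
    obtain ⟨y, ⟨hdy, hyx⟩, hyU⟩ := mem_closure_iff_nhds.1 hx _
      (inter_mem (Ioi_mem_nhds hdx) (Iic_mem_nhds_of_wellFoundedLT x))
    obtain ⟨γ, hγ, hyγ⟩ := mem_iUnion₂.1 hyU
    have hyx' : y < x := lt_of_le_of_ne hyx fun h => hxU (h ▸ hyU)
    obtain ⟨d', hd', hyd', hdx'⟩ := hlim.2 y hyx'
    have hyB := hCB γ hγ hyγ
    have hγd : γ ≤ d' := le_of_not_gt fun h => (hyB.2 d' hd' h).not_gt hyd'
    obtain ⟨k, hkK, hk⟩ := hCK γ hγ ⟨y, hyγ⟩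
    exact ⟨k, hkK, had.trans (hk.2 d hd (lt_of_lt_of_le hdy hyB.1)),
      (hk.1.trans hγd).trans_lt hdx'⟩
  · left
    obtain ⟨β, hβ, hxβ⟩ := exists_mem_clubBlock hD.isCofinal x
    -- Away from the limits of `D`, the block is a neighbourhood, so only `C β` can accumulate at
    -- `x`.
    have hB : clubBlock D β ∈ 𝓝 x := by
      by_cases hbot : ∃ a, a < x
      · have : ∃ a < x, ∀ d ∈ D, a < d → x ≤ d := by
          by_contra! h
          exact hlim ⟨hbot, h⟩
        obtain ⟨a, hax, ha⟩ := this
        filter_upwards [Ioi_mem_nhds hax, Iic_mem_nhds_of_wellFoundedLT x] with z hz hzx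
        refine ⟨le_trans hzx hxβ.1, fun d hd hdβ => lt_of_le_of_lt (le_of_not_gt fun had => ?_) hz⟩
        exact (ha d hd had).not_gt (hxβ.2 d hd hdβ)
      · filter_upwards [Iic_mem_nhds_of_wellFoundedLT x] with z hz
        have : z = x := eq_of_le_of_not_lt hz fun h => hbot ⟨z, h⟩
        exact this ▸ hxβ
    have hxC : x ∈ closure (C β) := by
      refine mem_closure_iff_nhds.2 fun V hV => ?_
      obtain ⟨y, ⟨hyV, hyB⟩, hyU⟩ := mem_closure_iff_nhds.1 hx _ (inter_mem hV hB)
      obtain ⟨γ, hγ, hyγ⟩ := mem_iUnion₂.1 hyU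
      obtain rfl := clubBlock_unique hβ hγ hyB (hCB γ hγ hyγ)
      exact ⟨y, hyV, hyγ⟩
    rw [(hC β hβ).closure_eq] at hxC
    exact mem_biUnion hβ hxC

/-- A well-order with a point is conditionally complete with a bottom, so its closed intervals are
compact. -/
theorem isCompact_of_isClosed_of_bddAbove [WellFoundedLT α] {K : Set α}
    (hK : IsClosed K) (hb : BddAbove K) : IsCompact K := by
  rcases K.eq_empty_or_nonempty with rfl | ⟨x, -⟩
  · exact isCompact_empty
  have : Nonempty α := ⟨x⟩
  let _ := WellFoundedLT.toOrderBot α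
  let _ := WellFoundedLT.conditionallyCompleteLinearOrderBot α
  obtain ⟨b, hb⟩ := hb
  exact (isCompact_Icc (a := ⊥) (b := b)).of_isClosed_subset hK fun x hx => ⟨bot_le, hb hx⟩

theorem isCompact_closure_iUnion_clubBlock [WellFoundedLT α] [NoMaxOrder α] {D : Set α} (hD : IsClub D) {C : α → Set α}
    (hCB : ∀ β ∈ D, C β ⊆ clubBlock D β) {K : Set α} (hK : IsCompact K)
    (hCK : ∀ β ∈ D, (C β).Nonempty → (K ∩ clubBlock D β).Nonempty) :
    IsCompact (closure (⋃ β ∈ D, C β)) := by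
  rcases isEmpty_or_nonempty α with h | h
  · exact (Set.toFinite _).isCompact
  refine isCompact_of_isClosed_of_bddAbove isClosed_closure (BddAbove.closure ?_)
  obtain ⟨b, hb⟩ := hK.bddAbove
  obtain ⟨d, hd, hbd⟩ := hD.isCofinal b
  refine ⟨d, fun x hx => ?_⟩
  obtain ⟨β, hβ, hxβ⟩ := mem_iUnion₂.1 hx
  obtain ⟨k, hkK, hk⟩ := hCK β hβ ⟨x, hxβ⟩
  refine (hCB β hβ hxβ).1.trans (le_of_not_gt fun h => ?_)
  exact (hk.2 d hd h).not_ge ((hb hkK).trans hbd)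

theorem localTukey_of_mem_leftLimits [FirstCountableTopology α] {S T B : Set α} {a x : α}
    (hax : a < x) (hxS : x ∈ S) (hx : x ∈ leftLimits (closure S \ S)) (hB : Ioc a x ⊆ B)
    {X : Set α} (hX : IsCompact X) (hXc : X.Countable) (hBX : B ⊆ X) : LocalTukey S T B := by
  classical
  obtain ⟨g, hg⟩ := exists_tukey_to_nat_fun (T := T ∩ B) hX (hXc.mono sdiff_subset)
  have hXB : X ∩ (T ∩ B) = T ∩ B := inter_eq_right.2 (inter_subset_right.trans hBX)
  rw [hXB] at hg
  obtain ⟨h, hh, hhK⟩ := exists_tukey_of_nat_fun hax hxS hx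
  -- The values of `h` are never empty, so `∅` is treated separately.
  refine ⟨fun L => if L = ∅ then ∅ else h (g L), if_pos rfl, fun L hL hc => ?_, fun K hKS hK => ?_⟩
  · dsimp only
    split_ifs with h0
    · exact ⟨empty_subset _, isCompact_empty, fun h => absurd h0 h.ne_empty⟩
    · exact ⟨(hh _).1.trans (inter_subset_inter_right _ hB), (hh _).2.1, fun _ => (hh _).2.2⟩
  · obtain ⟨b, hb⟩ := hhK K hKS hK
    obtain ⟨M, hM, hMc, hLM⟩ := hg b
    refine ⟨M, hM, hMc, fun L hL hc hLK => ?_⟩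
    dsimp only at hLK
    split_ifs at hLK with h0
    · exact h0 ▸ empty_subset _
    · exact hLM L hL hc (hb _ hLK)

theorem isClosed_clubBlock [WellFoundedLT α] [NoMaxOrder α] (D : Set α) (β : α) :
    IsClosed (clubBlock D β) := by
  have hIoi : ∀ d : α, IsClosed (Ioi d) := fun d => by
    rw [← isOpen_compl_iff, compl_Ioi, isOpen_iff_mem_nhds]
    exact fun x hx => mem_of_superset (Iic_mem_nhds_of_wellFoundedLT x) (Iic_subset_Iic.2 hx)
  have : clubBlock D β = Iic β ∩ ⋂ d ∈ {d | d ∈ D ∧ d < β}, Ioi d := by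
    ext x
    simp [clubBlock]
  rw [this]
  exact isClosed_Iic.inter (isClosed_biInter fun d _ => hIoi d)

/-- Local Tukey maps on the blocks of a club `D` glue, when `S` and `T` agree on `D`. -/
theorem exists_tukey_of_localTukey [WellFoundedLT α] [NoMaxOrder α] {S T D : Set α} (hD : IsClub D) (hST : ∀ x ∈ D, x ∈ S ↔ x ∈ T)
    (hloc : ∀ β ∈ D, LocalTukey S T (clubBlock D β)) :
    ∃ ψ : Set α → Set α, (∀ L ⊆ T, IsCompact L → ψ L ⊆ S ∧ IsCompact (ψ L)) ∧
      ∀ K ⊆ S, IsCompact K → ∃ M ⊆ T, IsCompact M ∧ ∀ L ⊆ T, IsCompact L → ψ L ⊆ K → L ⊆ M := by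
  choose! A hA0 hA hAK using hloc
  have hLB : ∀ L ⊆ T, ∀ β, L ∩ clubBlock D β ⊆ T ∩ clubBlock D β :=
    fun L hL β => inter_subset_inter_left _ hL
  have hLc : ∀ L : Set α, IsCompact L → ∀ β, IsCompact (L ∩ clubBlock D β) :=
    fun L hL β => hL.inter_right (isClosed_clubBlock D β)
  have hne : ∀ L : Set α, ∀ β ∈ D, (A β (L ∩ clubBlock D β)).Nonempty →
      (L ∩ clubBlock D β).Nonempty := fun L β hβ h => by
    by_contra h0
    rw [not_nonempty_iff_eq_empty.1 h0, hA0 β hβ] at h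
    exact h.ne_empty rfl
  refine ⟨fun L => closure (⋃ β ∈ D, A β (L ∩ clubBlock D β)), fun L hL hc => ⟨?_, ?_⟩,
    fun K hKS hK => ?_⟩
  · refine (closure_iUnion_clubBlock_subset hD
      (fun β hβ => (hA β hβ _ (hLB L hL β) (hLc L hc β)).1.trans inter_subset_right)
      (fun β hβ => (hA β hβ _ (hLB L hL β) (hLc L hc β)).2.1.isClosed) hc.isClosed
      (hne L)).trans (union_subset (iUnion₂_subset fun β hβ => ?_) ?_)
    · exact (hA β hβ _ (hLB L hL β) (hLc L hc β)).1.trans inter_subset_left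
    · exact fun x hx => (hST x hx.2).2 (hL hx.1)
  · exact isCompact_closure_iUnion_clubBlock hD
      (fun β hβ => (hA β hβ _ (hLB L hL β) (hLc L hc β)).1.trans inter_subset_right) hc (hne L)
  · choose! M hMT hMc hM using fun β hβ => hAK β hβ K hKS hK
    -- Bounds in blocks missed by `K` are discarded: otherwise the union could be unbounded or
    -- accumulate outside `T`.
    let N : α → Set α := fun β => {x ∈ M β | (K ∩ clubBlock D β).Nonempty}
    have hNM : ∀ β, N β ⊆ M β := fun β => sep_subset _ _
    have hNB : ∀ β ∈ D, N β ⊆ clubBlock D β :=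
      fun β hβ => (hNM β).trans ((hMT β hβ).trans inter_subset_right)
    have hNc : ∀ β ∈ D, IsClosed (N β) := fun β hβ => by
      by_cases h : (K ∩ clubBlock D β).Nonempty
      · simpa [N, h] using (hMc β hβ).isClosed
      · simp [N, h]
    have hNK : ∀ β ∈ D, (N β).Nonempty → (K ∩ clubBlock D β).Nonempty :=
      fun β _ ⟨_, hx⟩ => hx.2
    refine ⟨closure (⋃ β ∈ D, N β), ?_, isCompact_closure_iUnion_clubBlock hD hNB hK hNK, ?_⟩
    · refine (closure_iUnion_clubBlock_subset hD hNB hNc hK.isClosed hNK).trans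
        (union_subset (iUnion₂_subset fun β hβ => ?_) fun x hx => (hST x hx.2).1 (hKS hx.1))
      exact (hNM β).trans ((hMT β hβ).trans inter_subset_left)
    · intro L hL hc hLK x hx
      obtain ⟨β, hβ, hxβ⟩ := exists_mem_clubBlock hD.isCofinal x
      have hAβ : A β (L ∩ clubBlock D β) ⊆ K :=
        (subset_biUnion_of_mem (u := fun β => A β (L ∩ clubBlock D β)) hβ).trans
          (subset_closure.trans hLK)
      obtain ⟨hAS, -, hAne⟩ := hA β hβ _ (hLB L hL β) (hLc L hc β)
      -- Preservation of nonemptiness shows that `K` meets this block, so its bound was kept.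
      obtain ⟨y, hy⟩ := hAne ⟨x, hx, hxβ⟩
      refine subset_closure (mem_biUnion hβ ⟨?_, y, hAβ hy, (hAS hy).2⟩)
      exact hM β hβ _ (hLB L hL β) (hLc L hc β) hAβ ⟨hx, hxβ⟩

theorem exists_tukey_of_isStationary [WellFoundedLT α] [NoMaxOrder α]
    (hα : Order.cof α ≠ Cardinal.aleph0) (hc : ∀ x : α, (Iic x).Countable)
    (hb : ∀ s : Set α, s.Countable → BddAbove s) {S T : Set α}
    (hN : ¬ BddAbove (closure S \ S)) (hS : IsStationary S)
    (hST : ¬ IsStationary (symmDiff S T)) :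
    ∃ ψ : Set α → Set α, (∀ L ⊆ T, IsCompact L → ψ L ⊆ S ∧ IsCompact (ψ L)) ∧
      ∀ K ⊆ S, IsCompact K → ∃ M ⊆ T, IsCompact M ∧ ∀ L ⊆ T, IsCompact L → ψ L ⊆ K → L ⊆ M := by
  have := firstCountableTopology_of_countable_Iio fun x : α => (hc x).mono Iio_subset_Iic_self
  obtain ⟨D₀, hD₀, hdisj⟩ := not_isStationary_iff.1 hST
  set X := S ∩ leftLimits (closure S \ S)
  have hXc : IsCofinal X :=
    hS.isCofinal_inter (isClub_leftLimits hb (not_bddAbove_iff_isCofinal.1 hN))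
  have hD : IsClub (D₀ ∩ leftLimits X) := hD₀.inter hα (isClub_leftLimits hb hXc)
  set D := D₀ ∩ leftLimits X
  have hSTD : ∀ x ∈ D, x ∈ S ↔ x ∈ T := fun x hx => by
    have : x ∉ symmDiff S T := fun h => disjoint_left.1 hdisj h hx.1
    simp only [mem_symmDiff] at this
    tauto
  refine exists_tukey_of_localTukey hD hSTD fun β hβ => ?_
  by_cases hlim : β ∈ leftLimits D
  · have hB : clubBlock D β ⊆ {β} := fun x hx => by
      by_contra hne
      obtain ⟨d, hd, hxd, hdβ⟩ := hlim.2 x (lt_of_le_of_ne hx.1 hne)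
      exact (hx.2 d hd hdβ).not_gt hxd
    refine localTukey_of_inter_eq ((finite_singleton β).subset hB) ?_
    ext x
    refine and_congr_left fun hx => hSTD x ?_
    rw [hB hx]
    exact hβ
  -- The block contains `Ioc a β`, and `β` is a limit of `X`, so a point of `X` lies inside.
  · have : ∃ a < β, ∀ d ∈ D, a < d → β ≤ d := by
      by_contra! h
      exact hlim ⟨hβ.2.1, h⟩
    obtain ⟨a, haβ, ha⟩ := this
    obtain ⟨x, hx, hax, hxβ⟩ := hβ.2.2 a haβ
    refine localTukey_of_mem_leftLimits hax hx.1 hx.2 (fun z hz => ?_)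
      (isCompact_of_isClosed_of_bddAbove isClosed_Iic bddAbove_Iic) (hc β) fun z hz => hz.1
    exact ⟨hz.2.trans hxβ.le, fun d hd hdβ =>
      lt_of_le_of_lt (le_of_not_gt fun had => (ha d hd had).not_gt hdβ) hz.1⟩

/-- The stationary complement meets the club of limits of `S` unboundedly. -/
theorem not_bddAbove_closure_diff_of_isStationary_compl [WellFoundedLT α] [NoMaxOrder α]
    (hb : ∀ s : Set α, s.Countable → BddAbove s) {S : Set α}
    (hS : IsStationary S) (hS' : IsStationary Sᶜ) : ¬ BddAbove (closure S \ S) := by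
  rw [not_bddAbove_iff_isCofinal]
  refine (hS'.isCofinal_inter (isClub_leftLimits hb hS.isCofinal)).mono fun x hx => ?_
  exact ⟨leftLimits_subset_closure S hx.2, hx.1⟩

end Topology

/-! ### Passage to Tukey quotients of `KK`. -/

theorem tukeyGE_of_forall_bound {P Q : Type*} [PartialOrder P] [PartialOrder Q] (ψ : Q → P)
    (h : ∀ p, ∃ q, ∀ r, ψ r ≤ p → r ≤ q) : TukeyGE P Q := by
  choose φ hφ using h
  refine ⟨φ, fun C hC q => ?_⟩
  obtain ⟨c, hc, hqc⟩ := hC (ψ q)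
  exact ⟨φ c, mem_image_of_mem φ hc, hφ c q hqc⟩

theorem tukeyGE_KK_of_exists {S T : Set OmegaOne}
    (h : ∃ ψ : Set OmegaOne → Set OmegaOne, (∀ L ⊆ T, IsCompact L → ψ L ⊆ S ∧ IsCompact (ψ L)) ∧
      ∀ K ⊆ S, IsCompact K → ∃ M ⊆ T, IsCompact M ∧ ∀ L ⊆ T, IsCompact L → ψ L ⊆ K → L ⊆ M) :
    TukeyGE (KK S) (KK T) := by
  obtain ⟨ψ, hψ, hb⟩ := h
  have hsub : ∀ {U : Set OmegaOne} (L : KK U), Subtype.val '' (L : Set U) ⊆ U :=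
    fun L => Subtype.coe_image_subset _ _
  have hcpt : ∀ {U : Set OmegaOne} (L : KK U), IsCompact (Subtype.val '' (L : Set U)) :=
    fun L => L.isCompact.image continuous_subtype_val
  have hpre : ∀ {U M : Set OmegaOne}, M ⊆ U → IsCompact M →
      IsCompact (Subtype.val ⁻¹' M : Set U) := fun {U M} hM hc => by
    rw [Subtype.isCompact_iff, Subtype.image_preimage_coe, inter_eq_right.2 hM]
    exact hc
  refine tukeyGE_of_forall_bound
    (fun L => ⟨Subtype.val ⁻¹' ψ (Subtype.val '' (L : Set T)),
      hpre (hψ _ (hsub L) (hcpt L)).1 (hψ _ (hsub L) (hcpt L)).2⟩) fun K => ?_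
  obtain ⟨M, hM, hMc, hLM⟩ := hb _ (hsub K) (hcpt K)
  refine ⟨⟨Subtype.val ⁻¹' M, hpre hM hMc⟩, fun L hL x hx => ?_⟩
  refine hLM _ (hsub L) (hcpt L) (fun y hy => ?_) (mem_image_of_mem _ hx)
  exact ⟨⟨y, (hψ _ (hsub L) (hcpt L)).1 hy⟩, hL hy, rfl⟩

/-! ### Order properties of `ω₁`. -/

namespace OmegaOne

theorem countable_Iic (x : OmegaOne) : (Iic x).Countable := by
  obtain ⟨o, ho⟩ := x
  have hx : Order.succ o < ω₁ := (Cardinal.isSuccLimit_omega 1).succ_lt ho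
  have hcard : (Order.succ o).card ≤ Cardinal.aleph0 := by
    rwa [← Cardinal.ord_aleph, Cardinal.lt_ord, ← Cardinal.succ_aleph0, Order.lt_succ_iff] at hx
  have hc : (Iio (Order.succ o)).Countable := by
    rw [← Cardinal.le_aleph0_iff_set_countable, Cardinal.mk_Iio_ordinal]
    exact Cardinal.lift_le_aleph0.2 hcard
  refine (hc.preimage (Subtype.val_injective (p := (· ∈ Iio ω₁)))).mono fun y hy => ?_
  exact Order.lt_succ_of_le (show y.1 ≤ o from hy)

theorem cof_eq : Order.cof OmegaOne = Cardinal.aleph 1 := by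
  rw [Ordinal.cof_Iio]
  simp

theorem bddAbove_of_countable (s : Set OmegaOne) (hs : s.Countable) : BddAbove s := by
  refine .of_not_isCofinal fun h => ?_
  have := Order.cof_le h
  rw [cof_eq] at this
  exact (Cardinal.aleph0_lt_aleph_one.trans_le this).not_ge hs.le_aleph0

instance : NoMaxOrder OmegaOne := by
  refine ⟨fun a => ?_⟩
  exact ⟨⟨Order.succ a.1, (Cardinal.isSuccLimit_omega 1).succ_lt a.2⟩, Order.lt_succ a.1⟩

end OmegaOne

theorem tukeyGE_KK_of_isStationary {S T : Set OmegaOne} (hN : ¬ BddAbove (closure S \ S))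
    (hS : IsStationary S) (hST : ¬ IsStationary (symmDiff S T)) : TukeyGE (KK S) (KK T) :=
  tukeyGE_KK_of_exists (exists_tukey_of_isStationary
    (OmegaOne.cof_eq ▸ Cardinal.aleph0_lt_aleph_one.ne') OmegaOne.countable_Iic
    OmegaOne.bddAbove_of_countable hN hS hST)

theorem mainTheorem5 :
    (∀ S T : Set OmegaOne, ¬ BddAbove (closure S \ S) → IsStationary S →
      ¬ IsStationary (symmDiff S T) → TukeyGE (KK S) (KK T)) ∧
    (∀ S T : Set OmegaOne, IsStationary S → IsStationary Sᶜ → IsStationary T → IsStationary Tᶜ →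
      ¬ IsStationary (symmDiff S T) → TukeyEquiv (KK S) (KK T)) := by
  refine ⟨fun S T hN hS hST => tukeyGE_KK_of_isStationary hN hS hST,
    fun S T hS hS' hT hT' hST => ⟨tukeyGE_KK_of_isStationary ?_ hS hST,
      tukeyGE_KK_of_isStationary ?_ hT (symmDiff_comm S T ▸ hST)⟩⟩
  · exact not_bddAbove_closure_diff_of_isStationary_compl OmegaOne.bddAbove_of_countable hS hS'
  · exact not_bddAbove_closure_diff_of_isStationary_compl OmegaOne.bddAbove_of_countable hT hT'
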